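/- **Proposition.** Consider the scalar system $x_{t+1} = a x_t + \eta_{t+1}$, $x_0 = 0$, where $a \ge 1.1$ and $\eta_1, \eta_2, \dots$ are i.i.d. standard Gaussian $\mathcal N(0,1)$ random variables. For an integer $T \ge 1$ let $$\hat a \in \operatorname*{arg\,min}_{b \in \mathbb R} \sum_{t=0}^{T} (x_{t+1} - b x_t)^2$$ be the ordinary least squares estimate of $a$ (almost surely unique). There is a universal constant $C > 0$ (independent of $a$, $T$, $\delta$ and of the underlying probability space) such that for all $a \ge 1.1$, all $T \ge 1$ and all $\delta \in (0, e^{-1})$ the following holds. 1. If $C a^2 T^2 a^{-T} > \delta^2$, then $$\mathbb P\Big( |a - \hat a| \ge \frac{C (1 - a^{-2})\, \delta}{-a^2 (\log \delta)^3} \Big) \ge \delta .$$ 2. If $C a^2 T^2 a^{-T} \le \delta^2$, then $$\mathbb P\Big( |a - \hat a| \ge \frac{C (1 - a^{-2})}{-\delta \log \delta}\, a^{-T} \Big) \ge \delta .$$ -/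

import Mathlib

/-- The scalar linear system `x (t + 1) = a * x t + η (t + 1)` driven by the noise `η`, started at
`x 0 = 0`. The value `η 0` is not used. -/
def scalarState {Ω : Type*} (a : ℝ) (η : ℕ → Ω → ℝ) : ℕ → Ω → ℝ
  | 0, _ => 0
  | t + 1, ω => a * scalarState a η t ω + η (t + 1) ω

/-- The least squares loss of the parameter `b` along the trajectory `x 0, …, x (T + 1)`. -/
def leastSquaresLoss (x : ℕ → ℝ) (T : ℕ) (b : ℝ) : ℝ :=
  ∑ t ∈ Finset.range (T + 1), (x (t + 1) - b * x t) ^ 2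

/-- `b` is an ordinary least squares (OLS) estimate from the trajectory `x 0, …, x (T + 1)`: a
global minimizer of the least squares loss. -/
def IsOLSEstimate (x : ℕ → ℝ) (T : ℕ) (b : ℝ) : Prop :=
  IsMinOn (leastSquaresLoss x T) Set.univ b

/-!
Write `T = n + 1`, `D = ∑ x_t ^ 2` and `N = ∑ x_t η_{t+1}`, both sums over `t ≤ T`. If `D > 0`,
the normal equation gives `(aHat - a) * D = N`, so that the error is at least `s` exactly when
`|N| ≥ s * D`.

The noise is treated in three independent groups: the first term `η_1`, the middle terms
`η_2, …, η_T`, and the last term `η_{T+1}`.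

* Since `x_t` is recovered from `x_{t+1}` by a contraction, `D ≤ 11 x_T ^ 2 + 100 S` with
  `S = ∑ η_t ^ 2` over the middle terms (`sum_sq_scalarState_le`). Moreover
  `x_T = a ^ n * (η_1 + R)`, where `R` depends on the middle terms only (`scalarState_succ_eq`).
  With probability at least `0.8` one has `|R| ≤ 100` and `S ≤ 10 T`, by Markov's inequality.
* Given the middle terms, `η_1 + R` is a shifted Gaussian, and the probability that its modulus lies
  in an interval `[L, U]` is bounded below explicitly.
* The last term enters `N` only through `x_T * η_{T+1}`, so `|N| ≥ |x_T| / 10` with conditional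
  probability at least `0.9`.

On these events `|N| ≥ s * D` as soon as `s * (11 x_T ^ 2 + 1000 T) ≤ |x_T| / 10`, which prescribes
`[L, U]` (`measureReal_large_error_ge`). If `s` is small compared with `a ^ (-n)`, the interval
`[0.1, 110]` is allowed and the error exceeds `s` with probability at least `0.64`; otherwise
`U = 2 L` of order `a ^ (-n) / s` is allowed and the probability is at least of that order. This is
the dichotomy `measureReal_abs_sub_olsEstimate_ge_dichotomy`, valid for `s * T ≤ 1e-6`.

Both regimes follow by inserting the level `s` in question. As `δ < exp (-1) < 0.64`, the first
alternative always suffices, and for the second one it remains to check `δ ≤ c * a ^ (-n) / s`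
(`first_regime_level`, `second_regime_level`). In the first regime this uses that `δ` is
exponentially small in `T`, so that the cube of `log δ` compensates the factor `T ^ 2`.
-/

/-! ### Deterministic estimates along a trajectory -/

/-- The first noise term enters the state `x (n + 1)` with the full weight `a ^ n`; relative to this
weight the later noise terms have geometrically decaying coefficients. -/
theorem scalarState_succ_eq {Ω : Type*} {a : ℝ} (ha : a ≠ 0) (η : ℕ → Ω → ℝ) (n : ℕ) (ω : Ω) :
    scalarState a η (n + 1) ω =
      a ^ n * (η 1 ω + ∑ k ∈ Finset.range n, a⁻¹ ^ (k + 1) * η (k + 2) ω) := by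
  induction n with
  | zero => simp [scalarState]
  | succ n ih =>
    rw [scalarState, ih, Finset.sum_range_succ, pow_succ a n, inv_pow, pow_succ a n]
    field_simp
    ring

/-- For `a ≥ 1.1` the sum of the squared states is dominated by the square of the last state, up to
the energy of the noise terms other than the first one. -/
theorem sum_sq_scalarState_le {Ω : Type*} {a : ℝ} (ha : 1.1 ≤ a) (η : ℕ → Ω → ℝ) (n : ℕ) (ω : Ω) :
    ∑ t ∈ Finset.range (n + 2), scalarState a η t ω ^ 2 ≤
      11 * scalarState a η (n + 1) ω ^ 2 + 100 * ∑ k ∈ Finset.range n, η (k + 2) ω ^ 2 := by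
  induction n with
  | zero =>
    simp only [Finset.sum_range_succ, Finset.range_zero, Finset.sum_empty, scalarState]
    nlinarith [sq_nonneg (a * 0 + η (0 + 1) ω)]
  | succ n ih =>
    rw [Finset.sum_range_succ, Finset.sum_range_succ (fun k => η (k + 2) ω ^ 2)]
    have hx : scalarState a η (n + 1 + 1) ω = a * scalarState a η (n + 1) ω + η (n + 2) ω := rfl
    set x := scalarState a η (n + 1) ω
    set y := scalarState a η (n + 1 + 1) ω
    have ha2 : 1.1 ^ 2 * x ^ 2 ≤ a ^ 2 * x ^ 2 := by gcongr
    -- `a x = y - η`, and `(y - η)² ≤ 1.1 y² + 11 η²`.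
    have h1 : a ^ 2 * x ^ 2 = (y - η (n + 2) ω) ^ 2 := by rw [hx]; ring
    have h2 : 0 ≤ (y + 10 * η (n + 2) ω) ^ 2 := sq_nonneg _
    nlinarith

/-- The normal equation of the least squares problem. -/
theorem IsOLSEstimate.normal_equation {x : ℕ → ℝ} {T : ℕ} {b : ℝ} (h : IsOLSEstimate x T b)
    (hD : 0 < ∑ t ∈ Finset.range (T + 1), x t ^ 2) :
    ∑ t ∈ Finset.range (T + 1), (x (t + 1) - b * x t) * x t = 0 := by
  set D := ∑ t ∈ Finset.range (T + 1), x t ^ 2 with hDdef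
  set G := ∑ t ∈ Finset.range (T + 1), (x (t + 1) - b * x t) * x t with hG
  have key : leastSquaresLoss x T (b + G / D) =
      leastSquaresLoss x T b - 2 * (G / D) * G + (G / D) ^ 2 * D := by
    simp only [leastSquaresLoss]
    conv_rhs => rw [hG, hDdef, Finset.mul_sum, Finset.mul_sum]
    rw [← hG, ← hDdef, ← Finset.sum_sub_distrib, ← Finset.sum_add_distrib]
    exact Finset.sum_congr rfl fun t _ => by ring
  have hmin : leastSquaresLoss x T b ≤ leastSquaresLoss x T (b + G / D) := h (Set.mem_univ _)
  have h2 : (G / D) ^ 2 * D = G / D * G := by field_simp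
  have h3 : 0 ≤ -(G / D * G) := by linarith
  have h4 : G / D * G = G ^ 2 / D := by ring
  rw [h4] at h3
  have h5 : G ^ 2 / D = 0 := le_antisymm (by linarith) (by positivity)
  simpa [hD.ne'] using h5

/-- The error of the least squares estimate is the ratio of the cross term of states and noise to
the energy of the states. -/
theorem IsOLSEstimate.sub_mul_eq {Ω : Type*} {a : ℝ} {η : ℕ → Ω → ℝ} {ω : Ω} {T : ℕ} {b : ℝ}
    (h : IsOLSEstimate (fun t => scalarState a η t ω) T b)
    (hD : 0 < ∑ t ∈ Finset.range (T + 1), scalarState a η t ω ^ 2) :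
    (b - a) * ∑ t ∈ Finset.range (T + 1), scalarState a η t ω ^ 2 =
      ∑ t ∈ Finset.range (T + 1), scalarState a η t ω * η (t + 1) ω := by
  have h0 := h.normal_equation hD
  rw [← sub_eq_zero, ← neg_eq_zero, ← h0, Finset.mul_sum, ← Finset.sum_sub_distrib,
    ← Finset.sum_neg_distrib]
  refine Finset.sum_congr rfl fun t _ => ?_
  simp only [scalarState]
  ring

/-! ### Standard Gaussian probabilities of intervals -/

open MeasureTheory ProbabilityTheory

theorem gaussianReal_real_eq_setIntegral (s : Set ℝ) :
    (gaussianReal 0 1).real s = ∫ x in s, gaussianPDFReal 0 1 x := by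
  rw [measureReal_def, gaussianReal_apply_eq_integral 0 one_ne_zero,
    ENNReal.toReal_ofReal (integral_nonneg fun x => gaussianPDFReal_nonneg 0 1 x)]

theorem gaussianPDFReal_le_half (x : ℝ) : gaussianPDFReal 0 1 x ≤ 1 / 2 := by
  rw [gaussianPDFReal]
  have h2 : 2 ≤ √(2 * Real.pi * ((1 : NNReal) : ℝ)) := by
    apply Real.le_sqrt_of_sq_le
    push_cast
    nlinarith [Real.pi_gt_three]
  have h3 : Real.exp (-(x - 0) ^ 2 / (2 * ((1 : NNReal) : ℝ))) ≤ 1 := by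
    rw [Real.exp_le_one_iff]
    push_cast
    nlinarith [sq_nonneg (x - 0)]
  calc _ ≤ (2 : ℝ)⁻¹ * 1 := by gcongr
    _ = 1 / 2 := by norm_num

theorem gaussianReal_real_ball_le (m : ℝ) {κ : ℝ} (hκ : 0 ≤ κ) :
    (gaussianReal 0 1).real {g | |g + m| < κ} ≤ κ := by
  have hs : {g : ℝ | |g + m| < κ} = Set.Ioo (-m - κ) (-m + κ) := by
    ext g; simp only [Set.mem_ofPred_eq, Set.mem_Ioo, abs_lt]
    constructor <;> rintro ⟨h1, h2⟩ <;> constructor <;> linarith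
  rw [hs, gaussianReal_real_eq_setIntegral]
  calc _ ≤ ∫ x in Set.Ioo (-m - κ) (-m + κ), (1 / 2 : ℝ) := by
        apply setIntegral_mono (integrable_gaussianPDFReal 0 1).integrableOn
        · exact integrableOn_const (by simp)
        · exact fun x => gaussianPDFReal_le_half x
    _ = κ := by
        rw [setIntegral_const, measureReal_def, Real.volume_Ioo, ENNReal.toReal_ofReal (by linarith)]
        simp; ring

/-- The density of the standard Gaussian is at least its value at `M` on `[-M, M]`. -/
theorem le_gaussianReal_real_Icc {l u M : ℝ} (hlu : l ≤ u) (hl : -M ≤ l) (hu : u ≤ M) :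
    (u - l) * gaussianPDFReal 0 1 M ≤ (gaussianReal 0 1).real (Set.Icc l u) := by
  rw [gaussianReal_real_eq_setIntegral]
  calc (u - l) * gaussianPDFReal 0 1 M = ∫ x in Set.Icc l u, gaussianPDFReal 0 1 M := by
        rw [setIntegral_const, measureReal_def, Real.volume_Icc, ENNReal.toReal_ofReal (by linarith)]
        simp
    _ ≤ _ := by
        apply setIntegral_mono_on (integrableOn_const (by simp))
          (integrable_gaussianPDFReal 0 1).integrableOn measurableSet_Icc
        intro x hx
        have hx2 : x ^ 2 ≤ M ^ 2 := sq_le_sq' (by linarith [hx.1]) (by linarith [hx.2])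
        simp only [gaussianPDFReal, sub_zero]
        gcongr

theorem integrable_sq_gaussianReal : Integrable (fun x : ℝ => x ^ 2) (gaussianReal 0 1) := by
  simpa using (memLp_id_gaussianReal (μ := 0) (v := 1) 2).integrable_sq

theorem integral_sq_gaussianReal : ∫ x, x ^ 2 ∂(gaussianReal 0 1) = 1 := by
  have h := variance_of_integral_eq_zero (μ := gaussianReal 0 1) (X := fun x : ℝ => x)
    aemeasurable_id (by simp [integral_id_gaussianReal])
  rw [← h, variance_fun_id_gaussianReal]; simp

theorem gaussianReal_real_abs_ge_ten_le : (gaussianReal 0 1).real {g : ℝ | 10 ≤ |g|} ≤ 1 / 100 := by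
  have h := mul_meas_ge_le_integral_of_nonneg (μ := gaussianReal 0 1) (f := fun x : ℝ => x ^ 2)
    (ae_of_all _ fun x => sq_nonneg x) integrable_sq_gaussianReal 100
  rw [integral_sq_gaussianReal] at h
  have hs : {g : ℝ | 10 ≤ |g|} = {g : ℝ | 100 ≤ g ^ 2} := by
    ext g
    simp only [Set.mem_ofPred_eq]
    rw [← sq_abs g]
    constructor <;> intro h <;> nlinarith [abs_nonneg g]
  rw [hs]
  linarith

/-- A shifted standard Gaussian lies in the annulus `0.1 ≤ |x| ≤ 110` with high probability. -/
theorem gaussianReal_real_annulus_ge {r : ℝ} (hr : |r| ≤ 100) :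
    0.89 ≤ (gaussianReal 0 1).real {h | 0.1 ≤ |h + r| ∧ |h + r| ≤ 110} := by
  have hm : MeasurableSet {h : ℝ | 0.1 ≤ |h + r| ∧ |h + r| ≤ 110} := by measurability
  have hc := probReal_compl_eq_one_sub (μ := gaussianReal 0 1) hm
  have hsub : {h : ℝ | 0.1 ≤ |h + r| ∧ |h + r| ≤ 110}ᶜ ⊆
      {g | |g + r| < 0.1} ∪ {g | 10 ≤ |g|} := by
    intro g hg
    simp only [Set.mem_compl_iff, Set.mem_ofPred_eq, not_and, not_le] at hg
    by_cases h1 : |g + r| < 0.1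
    · exact Or.inl h1
    · refine Or.inr ?_
      have h2 := hg (not_lt.1 h1)
      simp only [Set.mem_ofPred_eq]
      linarith [abs_add_le g r]
  have h1 := (measureReal_mono (μ := gaussianReal 0 1) hsub).trans (measureReal_union_le _ _)
  have h2 := gaussianReal_real_ball_le r (κ := 0.1) (by norm_num)
  have h3 := gaussianReal_real_abs_ge_ten_le
  norm_num at h2 h3 ⊢
  norm_num at hc h1
  linarith

/-- A shifted standard Gaussian lies in the thin annulus `U / 2 ≤ |x| ≤ U` with a probability that
is at least proportional to `U`. -/
theorem gaussianReal_real_thin_annulus_ge {r U : ℝ} (hr : |r| ≤ 100) (hU : 0 ≤ U) (hU1 : U ≤ 1) :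
    U / 2 * gaussianPDFReal 0 1 101 ≤
      (gaussianReal 0 1).real {h | U / 2 ≤ |h + r| ∧ |h + r| ≤ U} := by
  obtain ⟨hr1, hr2⟩ := abs_le.1 hr
  have h := le_gaussianReal_real_Icc (l := U / 2 - r) (u := U - r) (M := 101)
    (by linarith) (by linarith) (by linarith)
  have h2 : (U - r - (U / 2 - r)) = U / 2 := by ring
  rw [h2] at h
  refine h.trans (measureReal_mono ?_)
  rintro x ⟨hx1, hx2⟩
  have hx : 0 ≤ x + r := by linarith
  simp only [Set.mem_ofPred_eq, abs_of_nonneg hx]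
  constructor <;> linarith

/-! ### Conditioning on independent coordinates -/

/-- If `Y` is independent of `X` and, for every value `x ∈ A`, the section of `B` at `x` has
probability at least `p` under the law of `Y`, then `(X, Y) ∈ B` with probability at least
`p * ℙ(X ∈ A)`. -/
theorem mul_measureReal_preimage_le {Ω β γ : Type*} [MeasurableSpace Ω] [MeasurableSpace β]
    [MeasurableSpace γ] {μ : Measure Ω} [IsProbabilityMeasure μ] {X : Ω → β} {Y : Ω → γ}
    {ν : Measure γ} (hX : Measurable X) (hY : HasLaw Y ν μ) (hXY : IndepFun X Y μ)
    {A : Set β} {B : Set (β × γ)} (hA : MeasurableSet A) (hB : MeasurableSet B) {p : ℝ}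
    (h : ∀ x ∈ A, p ≤ ν.real {y | (x, y) ∈ B}) :
    p * μ.real {ω | X ω ∈ A} ≤ μ.real {ω | (X ω, Y ω) ∈ B} := by
  have hν : IsProbabilityMeasure ν := hY.map_eq ▸ Measure.isProbabilityMeasure_map hY.aemeasurable
  have hprod := hXY.map_prod_eq_prod_map_map hX.aemeasurable hY.aemeasurable
  rw [hY.map_eq] at hprod
  have hXp : IsProbabilityMeasure (μ.map X) := Measure.isProbabilityMeasure_map hX.aemeasurable
  have hBeq : μ {ω | (X ω, Y ω) ∈ B} = ((μ.map X).prod ν) B := by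
    rw [← hprod, Measure.map_apply_of_aemeasurable (hX.aemeasurable.prodMk hY.aemeasurable) hB]
    rfl
  have hAeq : μ {ω | X ω ∈ A} = (μ.map X) A := (Measure.map_apply hX hA).symm
  have hle : ENNReal.ofReal p * μ {ω | X ω ∈ A} ≤ μ {ω | (X ω, Y ω) ∈ B} := by
    rw [hAeq, hBeq, Measure.prod_apply hB, ← setLIntegral_const]
    refine (setLIntegral_mono_ae' hA (ae_of_all _ fun x hx => ?_)).trans
      (setLIntegral_le_lintegral A _)
    exact ENNReal.ofReal_le_of_le_toReal (h x hx)
  rcases le_or_gt 0 p with hp | hp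
  · have := ENNReal.toReal_mono (measure_ne_top _ _) hle
    rwa [ENNReal.toReal_mul, ENNReal.toReal_ofReal hp] at this
  · exact (mul_nonpos_of_nonpos_of_nonneg hp.le measureReal_nonneg).trans measureReal_nonneg

/-- A random variable that is measurable with respect to the members of an independent family with
indices in `S` is independent of every other member. -/
theorem indepFun_of_measurable_iSup {Ω β ι : Type*} [MeasurableSpace Ω] [MeasurableSpace β]
    {μ : Measure Ω} {e : ι → Ω → ℝ} (he : ∀ i, Measurable (e i)) (hind : iIndepFun e μ)
    {S : Set ι} {j : ι} (hj : j ∉ S) {X : Ω → β}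
    (hX : Measurable[⨆ i ∈ S, MeasurableSpace.comap (e i) inferInstance] X) :
    IndepFun X (e j) μ := by
  rw [IndepFun_iff_Indep]
  have h := indep_iSup_of_disjoint (m := fun i => MeasurableSpace.comap (e i) inferInstance)
    (fun i => (he i).comap_le) ((iIndepFun_iff_iIndep _ _ _).1 hind)
    (S := S) (T := {j}) (Set.disjoint_singleton_right.2 hj)
  rw [iSup_singleton] at h
  exact indep_of_indep_of_le_left h (measurable_iff_comap_le.1 hX)

theorem measurable_scalarState {Ω : Type*} [MeasurableSpace Ω] (a : ℝ) {η : ℕ → Ω → ℝ} {n : ℕ}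
    (h : ∀ t < n, Measurable (η (t + 1))) : Measurable (scalarState a η n) := by
  induction n with
  | zero => exact measurable_const
  | succ n ih =>
    exact ((ih fun t ht => h t (by omega)).const_mul a).add (h n (by omega))

/-! ### The probability of a large estimation error -/

/-- The part of the noise that follows the first term is of moderate size with probability at least
`0.8`, by Markov's inequality. -/
theorem measureReal_moderate_noise_ge {Ω : Type*} [MeasurableSpace Ω] {μ : Measure Ω}
    [IsProbabilityMeasure μ] {η : ℕ → Ω → ℝ} (hη : ∀ t, Measurable (η (t + 1)))
    (hlaw : ∀ t, HasLaw (η (t + 1)) (gaussianReal 0 1) μ) {a : ℝ} (ha : 1.1 ≤ a) (n : ℕ) :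
    0.8 ≤ μ.real {ω | |∑ k ∈ Finset.range n, a⁻¹ ^ (k + 1) * η (k + 2) ω| ≤ 100 ∧
      ∑ k ∈ Finset.range n, η (k + 2) ω ^ 2 ≤ 10 * (n + 1)} := by
  have ha0 : 0 < a := by linarith
  have hint : ∀ k, Integrable (fun ω => η (k + 2) ω ^ 2) μ := fun k => by
    have h := integrable_sq_gaussianReal
    rw [← (hlaw (k + 1)).map_eq] at h
    exact h.comp_measurable (hη (k + 1))
  have hval : ∀ k, ∫ ω, η (k + 2) ω ^ 2 ∂μ = 1 := fun k => by
    rw [← integral_sq_gaussianReal]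
    exact (hlaw (k + 1)).integral_comp (f := fun x : ℝ => x ^ 2) (by fun_prop)
  -- `Q` dominates the weighted sum, since `|x| ≤ (1 + x ^ 2) / 2`.
  set Q : Ω → ℝ := fun ω => ∑ k ∈ Finset.range n, a⁻¹ ^ (k + 1) * ((1 + η (k + 2) ω ^ 2) / 2)
  set S : Ω → ℝ := fun ω => ∑ k ∈ Finset.range n, η (k + 2) ω ^ 2
  have hQi : ∀ k ∈ Finset.range n,
      Integrable (fun ω => a⁻¹ ^ (k + 1) * ((1 + η (k + 2) ω ^ 2) / 2)) μ := fun k _ =>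
    (((integrable_const 1).add (hint k)).div_const 2).const_mul _
  have hQ : ∫ ω, Q ω ∂μ ≤ 10 := by
    have h1 : ∫ ω, Q ω ∂μ = ∑ k ∈ Finset.range n, a⁻¹ ^ (k + 1) := by
      rw [integral_finsetSum _ hQi]
      refine Finset.sum_congr rfl fun k _ => ?_
      rw [integral_const_mul, integral_div, integral_add (integrable_const 1) (hint k), hval]
      simp
    rw [h1]
    have h2 : ∀ m : ℕ, ∑ k ∈ Finset.range m, a⁻¹ ^ (k + 1) ≤ 10 * (1 - a⁻¹ ^ m) := fun m => by
      induction m with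
      | zero => simp
      | succ m ih =>
        rw [Finset.sum_range_succ, pow_succ]
        have h3 : a⁻¹ ≤ 10 / 11 := by
          rw [inv_le_comm₀ ha0 (by norm_num)]; norm_num at ha ⊢; linarith
        have h4 : 0 < a⁻¹ ^ m := by positivity
        nlinarith
    have h5 : 0 < a⁻¹ ^ n := by positivity
    linarith [h2 n]
  have hS : ∫ ω, S ω ∂μ ≤ n + 1 := by
    rw [integral_finsetSum _ fun k _ => hint k]
    simp [hval]
  have mQ := mul_meas_ge_le_integral_of_nonneg (μ := μ) (f := Q)
    (ae_of_all _ fun ω => Finset.sum_nonneg fun k _ => by positivity)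
    (integrable_finsetSum _ hQi) 100
  have mS := mul_meas_ge_le_integral_of_nonneg (μ := μ) (f := S)
    (ae_of_all _ fun ω => Finset.sum_nonneg fun k _ => by positivity)
    (integrable_finsetSum _ fun k _ => hint k) (10 * (n + 1))
  have mS' : μ.real {ω | 10 * ((n : ℝ) + 1) ≤ S ω} ≤ 1 / 10 := by
    have hn : (0 : ℝ) < n + 1 := by positivity
    have h6 := mS.trans hS
    by_contra! hcon
    nlinarith
  set E := {ω | |∑ k ∈ Finset.range n, a⁻¹ ^ (k + 1) * η (k + 2) ω| ≤ 100 ∧ S ω ≤ 10 * (n + 1)}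
  have hR : Measurable fun ω => ∑ k ∈ Finset.range n, a⁻¹ ^ (k + 1) * η (k + 2) ω :=
    Finset.measurable_fun_sum _ fun k _ => (hη (k + 1)).const_mul _
  have hSm : Measurable S := Finset.measurable_fun_sum _ fun k _ => (hη (k + 1)).pow_const 2
  have hE : MeasurableSet E :=
    (measurableSet_le hR.abs measurable_const).inter (measurableSet_le hSm measurable_const)
  have hc := probReal_compl_eq_one_sub (μ := μ) hE
  have hsub : Eᶜ ⊆ {ω | 100 ≤ Q ω} ∪ {ω | 10 * ((n : ℝ) + 1) ≤ S ω} := by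
    intro ω hω
    by_contra hcon
    simp only [Set.mem_union, Set.mem_ofPred_eq, not_or, not_le] at hcon
    refine hω ⟨?_, hcon.2.le⟩
    refine le_trans ?_ hcon.1.le
    refine (Finset.abs_sum_le_sum_abs _ _).trans (Finset.sum_le_sum fun k _ => ?_)
    rw [abs_mul, abs_of_nonneg (by positivity : 0 ≤ a⁻¹ ^ (k + 1))]
    gcongr
    nlinarith [sq_nonneg (|η (k + 2) ω| - 1), sq_abs (η (k + 2) ω)]
  have h7 := (measureReal_mono (μ := μ) hsub).trans (measureReal_union_le _ _)
  norm_num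
  linarith

/-- The last noise term shifts the cross term by a Gaussian multiple of the last state, so that the
cross term is unlikely to be small compared with the last state. -/
theorem le_gaussianReal_real_abs_affine_ge {x d r : ℝ} (hx : x ≠ 0) (hd : d ≤ |x| / 10) :
    0.9 ≤ (gaussianReal 0 1).real {g | d ≤ |r + x * g|} := by
  have hm : MeasurableSet {g : ℝ | |g + r / x| < 1 / 10} := by measurability
  have hc := probReal_compl_eq_one_sub (μ := gaussianReal 0 1) hm
  have hb := gaussianReal_real_ball_le (r / x) (κ := 1 / 10) (by norm_num)
  have hsub : {g : ℝ | |g + r / x| < 1 / 10}ᶜ ⊆ {g | d ≤ |r + x * g|} := by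
    intro g hg
    simp only [Set.mem_compl_iff, Set.mem_ofPred_eq, not_lt] at hg ⊢
    have h1 : r + x * g = x * (g + r / x) := by field_simp; ring
    rw [h1, abs_mul]
    nlinarith [abs_pos.2 hx]
  have h2 := measureReal_mono (μ := gaussianReal 0 1) hsub
  norm_num
  linarith

/-- The estimation error is at least `s` as soon as three things happen: the noise between the first
and the last term is moderate, the first noise term places the rescaled last state
`a ^ (-n) * x (n + 1)` into the annulus `[L, U]`, and the last noise term does not cancel the
rest of the cross term. -/
theorem measureReal_large_error_ge {Ω : Type*} [MeasurableSpace Ω] {μ : Measure Ω}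
    [IsProbabilityMeasure μ] {η : ℕ → Ω → ℝ} (hη : ∀ t, Measurable (η (t + 1)))
    (hind : iIndepFun (fun t => η (t + 1)) μ)
    (hlaw : ∀ t, HasLaw (η (t + 1)) (gaussianReal 0 1) μ) {a : ℝ} (ha : 1.1 ≤ a) {n : ℕ}
    {s L U p : ℝ} (hs : 0 < s) (hL : 0 < L) (hp : 0 ≤ p)
    (hLU : ∀ r : ℝ, |r| ≤ 100 → p ≤ (gaussianReal 0 1).real {h | L ≤ |h + r| ∧ |h + r| ≤ U})
    (hsU : 11 * (s * a ^ n) * U ≤ 1 / 20) (hsL : 1000 * (s * (n + 1)) ≤ 1 / 20 * (a ^ n * L)) :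
    0.72 * p ≤ μ.real {ω | 0 < ∑ t ∈ Finset.range (n + 2), scalarState a η t ω ^ 2 ∧
      s * ∑ t ∈ Finset.range (n + 2), scalarState a η t ω ^ 2 ≤
        |∑ t ∈ Finset.range (n + 2), scalarState a η t ω * η (t + 1) ω|} := by
  have ha0 : 0 < a := by linarith
  set R : Ω → ℝ := fun ω => ∑ k ∈ Finset.range n, a⁻¹ ^ (k + 1) * η (k + 2) ω
  set S : Ω → ℝ := fun ω => ∑ k ∈ Finset.range n, η (k + 2) ω ^ 2
  set D : Ω → ℝ := fun ω => ∑ t ∈ Finset.range (n + 2), scalarState a η t ω ^ 2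
  set N : Ω → ℝ := fun ω => ∑ t ∈ Finset.range (n + 1), scalarState a η t ω * η (t + 1) ω
  -- Conditioning on all noise terms but the first one.
  have hRS : ∀ {m : MeasurableSpace Ω}, (∀ k < n, Measurable[m] (η (k + 1 + 1))) →
      Measurable[m] fun ω => (R ω, S ω) := by
    intro m h
    refine Measurable.prodMk (Finset.measurable_fun_sum _ fun k hk => ?_)
      (Finset.measurable_fun_sum _ fun k hk => ?_)
    · exact (h k (Finset.mem_range.1 hk)).const_mul _
    · exact (h k (Finset.mem_range.1 hk)).pow_const 2
  have hI1 : IndepFun (fun ω => (R ω, S ω)) (η (0 + 1)) μ := by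
    refine indepFun_of_measurable_iSup (e := fun t => η (t + 1)) (S := {0}ᶜ) (j := 0) hη hind
      (by simp) (hRS fun k _ => ?_)
    exact (comap_measurable (η (k + 1 + 1))).mono
      (le_iSup₂ (f := fun i (_ : i ∈ ({0}ᶜ : Set ℕ)) =>
        MeasurableSpace.comap (η (i + 1)) inferInstance) (k + 1) (by simp)) le_rfl
  have step1 := mul_measureReal_preimage_le (hRS fun k _ => hη (k + 1)) (hlaw 0) hI1
    (A := {q : ℝ × ℝ | |q.1| ≤ 100 ∧ q.2 ≤ 10 * (n + 1)})
    (B := {z : (ℝ × ℝ) × ℝ | z.1.2 ≤ 10 * (n + 1) ∧ L ≤ |z.2 + z.1.1| ∧ |z.2 + z.1.1| ≤ U})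
    (p := p) (by measurability) (by measurability) (by
      rintro ⟨r, q⟩ ⟨hr, hq⟩
      refine (hLU r hr).trans (measureReal_mono ?_)
      exact fun h hh => ⟨hq, hh⟩)
  -- Conditioning on all noise terms but the last one.
  have hXND : ∀ {m : MeasurableSpace Ω}, (∀ t < n + 1, Measurable[m] (η (t + 1))) →
      Measurable[m] fun ω => (scalarState a η (n + 1) ω, N ω, D ω) := by
    intro m h
    have hx : ∀ t ≤ n + 1, Measurable[m] (scalarState a η t) := fun t ht =>
      measurable_scalarState a fun u hu => h u (by omega)
    refine Measurable.prodMk (hx _ le_rfl) (Measurable.prodMk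
      (Finset.measurable_fun_sum _ fun t ht => ?_) (Finset.measurable_fun_sum _ fun t ht => ?_))
    · have := Finset.mem_range.1 ht
      exact (hx t (by omega)).mul (h t this)
    · have := Finset.mem_range.1 ht
      exact (hx t (by omega)).pow_const 2
  have hI2 : IndepFun (fun ω => (scalarState a η (n + 1) ω, N ω, D ω)) (η (n + 1 + 1)) μ := by
    refine indepFun_of_measurable_iSup (e := fun t => η (t + 1)) (S := Set.Iio (n + 1))
      (j := n + 1) hη hind (by simp) (hXND fun t ht => ?_)
    exact (comap_measurable (η (t + 1))).mono
      (le_iSup₂ (f := fun i (_ : i ∈ Set.Iio (n + 1)) =>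
        MeasurableSpace.comap (η (i + 1)) inferInstance) t ht) le_rfl
  have step2 := mul_measureReal_preimage_le (hXND fun t _ => hη t) (hlaw (n + 1)) hI2
    (A := {q : ℝ × ℝ × ℝ | q.1 ≠ 0 ∧ 0 < q.2.2 ∧ s * q.2.2 ≤ |q.1| / 10})
    (B := {z : (ℝ × ℝ × ℝ) × ℝ | 0 < z.1.2.2 ∧ s * z.1.2.2 ≤ |z.1.2.1 + z.1.1 * z.2|})
    (p := 0.9) (by measurability) (by measurability) (by
      rintro ⟨x, r, d⟩ ⟨hx, hd, hsd⟩
      refine (le_gaussianReal_real_abs_affine_ge (r := r) hx hsd).trans (measureReal_mono ?_)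
      exact fun g hg => ⟨hd, hg⟩)
  have hfinal : {ω | ((scalarState a η (n + 1) ω, N ω, D ω), η (n + 1 + 1) ω) ∈
      {z : (ℝ × ℝ × ℝ) × ℝ | 0 < z.1.2.2 ∧ s * z.1.2.2 ≤ |z.1.2.1 + z.1.1 * z.2|}} =
      {ω | 0 < D ω ∧ s * D ω ≤
        |∑ t ∈ Finset.range (n + 2), scalarState a η t ω * η (t + 1) ω|} := by
    ext ω
    simp only [Set.mem_ofPred_eq, N, Finset.sum_range_succ _ (n + 1)]
  -- The first event makes the energy of the states small compared with the last state.
  have hmid : {ω | ((R ω, S ω), η (0 + 1) ω) ∈ {z : (ℝ × ℝ) × ℝ |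
      z.1.2 ≤ 10 * (n + 1) ∧ L ≤ |z.2 + z.1.1| ∧ |z.2 + z.1.1| ≤ U}} ⊆
      {ω | (scalarState a η (n + 1) ω, N ω, D ω) ∈
        {q : ℝ × ℝ × ℝ | q.1 ≠ 0 ∧ 0 < q.2.2 ∧ s * q.2.2 ≤ |q.1| / 10}} := by
    rintro ω ⟨hSω, hLω, hUω⟩
    simp only [Set.mem_ofPred_eq] at hSω hLω hUω ⊢
    have hx := scalarState_succ_eq ha0.ne' η n ω
    set w := |η (0 + 1) ω + R ω|
    have hm : 0 < a ^ n := by positivity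
    have hxa : |scalarState a η (n + 1) ω| = a ^ n * w := by
      rw [hx, abs_mul, abs_of_pos hm]
    have hw0 : 0 < w := hL.trans_le hLω
    have hx0 : scalarState a η (n + 1) ω ≠ 0 := by
      rw [← abs_pos, hxa]; positivity
    refine ⟨hx0, ?_, ?_⟩
    · exact lt_of_lt_of_le (by positivity) (Finset.single_le_sum
        (f := fun t => scalarState a η t ω ^ 2) (fun t _ => sq_nonneg _)
        (Finset.mem_range.2 (by omega : n + 1 < n + 2)))
    · have hD : D ω ≤ 11 * scalarState a η (n + 1) ω ^ 2 + 100 * S ω :=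
        sum_sq_scalarState_le ha η n ω
      rw [← sq_abs, hxa] at hD
      rw [hxa]
      have h1 : 11 * (s * a ^ n) * w ≤ 1 / 20 :=
        (mul_le_mul_of_nonneg_left hUω (by positivity)).trans hsU
      have h2 : 11 * (s * a ^ n) * w * (a ^ n * w) ≤ 1 / 20 * (a ^ n * w) := by gcongr
      have h3 : a ^ n * L ≤ a ^ n * w := by gcongr
      calc s * D ω ≤ s * (11 * (a ^ n * w) ^ 2 + 100 * (10 * (n + 1))) := by
            gcongr; linarith
        _ = 11 * (s * a ^ n) * w * (a ^ n * w) + 1000 * (s * (n + 1)) := by ring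
        _ ≤ a ^ n * w / 10 := by linarith
  rw [hfinal] at step2
  have h8 := measureReal_moderate_noise_ge hη hlaw ha n
  have h9 := measureReal_mono (μ := μ) hmid
  have h10 : p * 0.8 ≤ p * μ.real {ω | (R ω, S ω) ∈
      {q : ℝ × ℝ | |q.1| ≤ 100 ∧ q.2 ≤ 10 * ((n : ℝ) + 1)}} := by
    gcongr
    exact h8
  calc 0.72 * p = 0.9 * (p * 0.8) := by ring
    _ ≤ 0.9 * _ := by gcongr; exact h10.trans (step1.trans h9)
    _ ≤ _ := step2

/-- The lower bound on the probability of a large error, for the least squares estimate itself and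
for noise terms that are only almost everywhere measurable. -/
theorem measureReal_abs_sub_olsEstimate_ge {Ω : Type*} [MeasurableSpace Ω] {μ : Measure Ω}
    [IsProbabilityMeasure μ] {η : ℕ → Ω → ℝ} (hind : iIndepFun (fun t => η (t + 1)) μ)
    (hlaw : ∀ t, HasLaw (η (t + 1)) (gaussianReal 0 1) μ) {a : ℝ} (ha : 1.1 ≤ a) {n : ℕ}
    {aHat : Ω → ℝ}
    (hols : ∀ᵐ ω ∂μ, IsOLSEstimate (fun t => scalarState a η t ω) (n + 1) (aHat ω))
    {s L U p : ℝ} (hs : 0 < s) (hL : 0 < L) (hp : 0 ≤ p)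
    (hLU : ∀ r : ℝ, |r| ≤ 100 → p ≤ (gaussianReal 0 1).real {h | L ≤ |h + r| ∧ |h + r| ≤ U})
    (hsU : 11 * (s * a ^ n) * U ≤ 1 / 20) (hsL : 1000 * (s * (n + 1)) ≤ 1 / 20 * (a ^ n * L)) :
    0.72 * p ≤ μ.real {ω | |a - aHat ω| ≥ s} := by
  -- A measurable version of the noise; the unused value at `0` is irrelevant.
  let η' : ℕ → Ω → ℝ := fun t => (hlaw (t - 1)).aemeasurable.mk _
  have heq : ∀ t, η (t + 1) =ᵐ[μ] η' (t + 1) := fun t => (hlaw t).aemeasurable.ae_eq_mk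
  have key := measureReal_large_error_ge (μ := μ) (η := η')
    (fun t => (hlaw t).aemeasurable.measurable_mk) (hind.congr heq)
    (fun t => (hlaw t).congr (heq t).symm) ha hs hL hp hLU hsU hsL
  refine key.trans ?_
  simp only [measureReal_def]
  refine ENNReal.toReal_mono (measure_ne_top _ _) (measure_mono_ae ?_)
  filter_upwards [hols, ae_all_iff.2 heq] with ω hω heqω ⟨hD, hN⟩
  have hx : ∀ t, scalarState a η' t ω = scalarState a η t ω := fun t => by
    induction t with
    | zero => rfl
    | succ t ih => simp only [scalarState, ih, heqω]
  simp only [hx, ← heqω] at hD hN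
  have herr := hω.sub_mul_eq hD
  change s ≤ |a - aHat ω|
  rw [← herr, abs_mul, abs_of_pos hD, abs_sub_comm] at hN
  exact le_of_mul_le_mul_right hN hD

/-- For a small error level `s`, the error exceeds `s` with probability at least `0.64` if `s` is
small compared with `a ^ (-n)`, and with probability at least a constant multiple of `a ^ (-n) / s`
otherwise. -/
theorem measureReal_abs_sub_olsEstimate_ge_dichotomy {Ω : Type*} [MeasurableSpace Ω] {μ : Measure Ω}
    [IsProbabilityMeasure μ] {η : ℕ → Ω → ℝ} (hind : iIndepFun (fun t => η (t + 1)) μ)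
    (hlaw : ∀ t, HasLaw (η (t + 1)) (gaussianReal 0 1) μ) {a : ℝ} (ha : 1.1 ≤ a) {n : ℕ}
    {aHat : Ω → ℝ}
    (hols : ∀ᵐ ω ∂μ, IsOLSEstimate (fun t => scalarState a η t ω) (n + 1) (aHat ω))
    {s : ℝ} (hs : 0 < s) (hsT : s * (n + 1) ≤ 1e-6) :
    0.64 ≤ μ.real {ω | |a - aHat ω| ≥ s} ∨
      3.6e-7 * gaussianPDFReal 0 1 101 / (s * a ^ n) ≤ μ.real {ω | |a - aHat ω| ≥ s} := by
  have hm : 1 ≤ a ^ n := one_le_pow₀ (by linarith)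
  have hsm : 0 < s * a ^ n := by positivity
  have hs1 : s ≤ 1e-6 :=
    (le_mul_of_one_le_right hs.le (by linarith [n.cast_nonneg (α := ℝ)])).trans hsT
  rcases le_or_gt (s * a ^ n) 1e-6 with h | h
  · left
    have := measureReal_abs_sub_olsEstimate_ge hind hlaw ha hols hs (L := 0.1) (U := 110)
      (p := 0.89) (by norm_num) (by norm_num) (fun r hr => gaussianReal_real_annulus_ge hr)
      (by norm_num at h ⊢; linarith) (by norm_num at hsT ⊢; linarith)
    norm_num at this ⊢
    linarith
  · right
    -- The annulus is chosen so that `s * x ^ 2 ≈ 1e-6 * |x|` for the last state `x`.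
    have hU : 0 < 1e-6 / (s * a ^ n) := by positivity
    have := measureReal_abs_sub_olsEstimate_ge hind hlaw ha hols hs
      (L := 1e-6 / (s * a ^ n) / 2) (U := 1e-6 / (s * a ^ n))
      (p := 1e-6 / (s * a ^ n) / 2 * gaussianPDFReal 0 1 101) (by positivity)
      (mul_nonneg (by positivity) (gaussianPDFReal_nonneg _ _ _))
      (fun r hr => gaussianReal_real_thin_annulus_ge hr hU.le ((div_le_one hsm).2 h.le))
      (by rw [mul_assoc, mul_div_cancel₀ _ hsm.ne']; norm_num)
      (by
        have h1 : a ^ n * (1e-6 / (s * a ^ n) / 2) = 5e-7 / s := by field_simp; norm_num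
        rw [h1, mul_div_assoc', le_div_iff₀ hs]
        have h2 : s * (n + 1) * s ≤ 1e-6 * 1e-6 := by gcongr
        norm_num at h2 ⊢
        linarith)
    refine le_trans (le_of_eq ?_) this
    ring

/-! ### Choice of the constant -/

theorem one_div_eleven_le_log : 1 / 11 ≤ Real.log 1.1 := by
  have := Real.one_sub_inv_le_log_of_pos (x := 1.1) (by norm_num)
  norm_num at this ⊢; linarith

theorem pow_four_le_mul_pow (n : ℕ) : ((n : ℝ) + 1) ^ 4 ≤ 400000 * 1.1 ^ n := by
  have hlog := one_div_eleven_le_log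
  have hn : (0 : ℝ) ≤ n + 1 := by positivity
  have h1 := Real.pow_div_factorial_le_exp (((n : ℝ) + 1) * Real.log 1.1) (by positivity) 4
  have h2 : Real.exp (((n : ℝ) + 1) * Real.log 1.1) = 1.1 ^ n * 1.1 := by
    rw [← Nat.cast_succ, mul_comm, Real.exp_mul, Real.exp_log (by norm_num), Real.rpow_natCast,
      pow_succ]
  rw [h2] at h1
  have h3 : (((n : ℝ) + 1) * (1 / 11)) ^ 4 ≤ (((n : ℝ) + 1) * Real.log 1.1) ^ 4 := by gcongr
  have h4 : (Nat.factorial 4 : ℝ) = 24 := by norm_num [Nat.factorial]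
  rw [h4, div_le_iff₀ (by norm_num)] at h1
  have h5 : (0 : ℝ) < 1.1 ^ n := by positivity
  have h6 : (((n : ℝ) + 1) * (1 / 11)) ^ 4 = ((n : ℝ) + 1) ^ 4 / 14641 := by ring
  rw [h6] at h3
  linarith

/-- In the first regime `δ` is exponentially small in `T = n + 1`, that is, `-log δ` is at least of
order `T`. -/
theorem le_neg_log_of_sq_mul_pow_lt {a C δ : ℝ} (ha : 1.1 ≤ a) (hC : 0 < C) (hC1 : C ≤ 1e-4)
    (hδ : 0 < δ) (hδ1 : 1 ≤ -Real.log δ) {n : ℕ} (h : δ ^ 2 * a ^ n < C * a * (n + 1) ^ 2) :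
    ((n : ℝ) + 1) / 44 ≤ -Real.log δ := by
  rcases n with _ | n
  · norm_num; linarith
  have ha0 : 0 < a := by linarith
  have h1 : δ ^ 2 * a ^ n < C * ((n + 1 : ℕ) + 1 : ℝ) ^ 2 := by
    refine lt_of_mul_lt_mul_right ?_ ha0.le
    calc _ = δ ^ 2 * a ^ (n + 1) := by ring
      _ < _ := h
      _ = _ := by ring
  have h2 : δ ^ 2 * 1.1 ^ n ≤ C * ((n + 1 : ℕ) + 1 : ℝ) ^ 2 := by
    refine le_trans ?_ h1.le
    gcongr
  have h3 : (δ ^ 2 * 1.1 ^ n) ^ 2 ≤ (C * ((n + 1 : ℕ) + 1 : ℝ) ^ 2) ^ 2 := by gcongr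
  have h4 := pow_four_le_mul_pow (n + 1)
  have hq : (0 : ℝ) < 1.1 ^ n := by positivity
  have h5 : δ ^ 4 * 1.1 ^ n ≤ C ^ 2 * 440000 := by
    refine le_of_mul_le_mul_right (a := (1.1 : ℝ) ^ n) ?_ hq
    calc _ = (δ ^ 2 * 1.1 ^ n) ^ 2 := by ring
      _ ≤ _ := h3
      _ = C ^ 2 * ((n + 1 : ℕ) + 1 : ℝ) ^ 4 := by ring
      _ ≤ C ^ 2 * (400000 * 1.1 ^ (n + 1)) := by gcongr
      _ = _ := by ring
  have h6 : C ^ 2 ≤ 1e-4 ^ 2 := by gcongr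
  have h7 : δ ^ 4 * 1.1 ^ (n + 2) ≤ 1 := by
    have : δ ^ 4 * 1.1 ^ (n + 2) = δ ^ 4 * 1.1 ^ n * 1.21 := by ring
    norm_num at h6 this h5 ⊢
    linarith
  have h8 := Real.log_nonpos (by positivity) h7
  rw [Real.log_mul (by positivity) (by positivity), Real.log_pow, Real.log_pow] at h8
  have hlog := one_div_eleven_le_log
  have h9 : ((n + 2 : ℕ) : ℝ) * (1 / 11) ≤ ((n + 2 : ℕ) : ℝ) * Real.log 1.1 := by gcongr
  push_cast at h8 h9 ⊢
  linarith

/-- The numerical facts about the error level of the first regime. -/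
theorem first_regime_level {a C c δ : ℝ} (ha : 1.1 ≤ a) (hC : 0 < C) (hC1 : C ≤ 1e-12)
    (hc : C ≤ c) (hδ : 0 < δ) (hδ1 : 1 ≤ -Real.log δ) {n : ℕ}
    (h : δ ^ 2 * a ^ n < C * a * (n + 1) ^ 2) {s : ℝ} (hs : 0 < s)
    (hsle : s ≤ C * δ / (a ^ 2 * (-Real.log δ) ^ 3)) :
    s * (n + 1) ≤ 1e-6 ∧ δ ≤ c / (s * a ^ n) := by
  have ha0 : 0 < a := by linarith
  have ha1 : 1 ≤ a := by linarith
  set l := -Real.log δ with hl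
  have hl0 : 0 < l := by linarith
  have hln : ((n : ℝ) + 1) / 44 ≤ l :=
    le_neg_log_of_sq_mul_pow_lt ha hC (hC1.trans (by norm_num)) hδ hδ1 h
  set T : ℝ := (n : ℝ) + 1 with hT
  have hT0 : 0 < T := by positivity
  have hm : 0 < a ^ n := by positivity
  rw [le_div_iff₀ (by positivity)] at hsle
  have ha3 : 1 ≤ a ^ 2 := one_le_pow₀ ha1
  have hl3 : 1 ≤ l ^ 3 := one_le_pow₀ hδ1
  constructor
  · have hpow : T ^ 4 ≤ 400000 * a ^ n := (pow_four_le_mul_pow n).trans (by gcongr)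
    have h1 : s * a ^ 2 ≤ C * δ := by
      refine le_trans ?_ hsle
      have : s * a ^ 2 * 1 ≤ s * a ^ 2 * l ^ 3 := by gcongr
      linarith
    have h2 : (s * T) ^ 2 * a ^ n ≤ (1e-6) ^ 2 * a ^ n := by
      calc (s * T) ^ 2 * a ^ n ≤ (s * T) ^ 2 * a ^ n * a ^ 3 :=
            le_mul_of_one_le_right (by positivity) (one_le_pow₀ ha1)
        _ = (s * a ^ 2) ^ 2 * T ^ 2 * a ^ n / a := by field_simp
        _ ≤ (C * δ) ^ 2 * T ^ 2 * a ^ n / a := by gcongr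
        _ = C ^ 2 * T ^ 2 * (δ ^ 2 * a ^ n) / a := by ring
        _ ≤ C ^ 2 * T ^ 2 * (C * a * T ^ 2) / a := by gcongr
        _ = C ^ 3 * T ^ 4 := by field_simp
        _ ≤ (1e-12) ^ 3 * (400000 * a ^ n) := by gcongr
        _ ≤ _ := by norm_num; linarith
    exact le_of_sq_le_sq (le_of_mul_le_mul_right h2 hm) (by norm_num)
  · rw [le_div_iff₀ (by positivity)]
    have hT2 : T ^ 2 ≤ 1936 * l ^ 3 := by
      have h1 : (T / 44) ^ 2 ≤ l ^ 2 := by gcongr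
      have h2 : l ^ 2 * 1 ≤ l ^ 2 * l := by gcongr
      have h3 : (T / 44) ^ 2 = T ^ 2 / 1936 := by ring
      have h4 : l ^ 3 = l ^ 2 * l := by ring
      rw [h3] at h1
      linarith
    refine le_of_mul_le_mul_right (a := a ^ 2 * l ^ 3) ?_ (by positivity)
    calc δ * (s * a ^ n) * (a ^ 2 * l ^ 3) = δ * a ^ n * (s * (a ^ 2 * l ^ 3)) := by ring
      _ ≤ δ * a ^ n * (C * δ) := by gcongr
      _ = C * (δ ^ 2 * a ^ n) := by ring
      _ ≤ C * (C * a * T ^ 2) := by gcongr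
      _ ≤ C * (1e-12 * a * (1936 * l ^ 3)) := by gcongr
      _ = C * (1.936e-9 * (a * l ^ 3)) := by ring
      _ ≤ c * (1 * (a ^ 2 * l ^ 3)) := by
        have : a ≤ a ^ 2 := by nlinarith
        gcongr
        · linarith
        · norm_num
      _ = _ := by ring

/-- The numerical facts about the error level of the second regime. -/
theorem second_regime_level {a C c δ : ℝ} (ha : 1.1 ≤ a) (hC : 0 < C) (hC1 : C ≤ 1e-12)
    (hc : C ≤ c) (hδ : 0 < δ) (hδ1 : 1 ≤ -Real.log δ) {n : ℕ}
    (h : C * a * (n + 1) ^ 2 ≤ δ ^ 2 * a ^ n) {s : ℝ} (hs : 0 < s)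
    (hsle : s ≤ C / (δ * -Real.log δ * (a * a ^ n))) :
    s * (n + 1) ≤ 1e-6 ∧ δ ≤ c / (s * a ^ n) := by
  have ha0 : 0 < a := by linarith
  have ha1 : 1 ≤ a := by linarith
  set l := -Real.log δ
  have hl0 : 0 < l := by linarith
  set T : ℝ := (n : ℝ) + 1
  have hT0 : 0 < T := by positivity
  have hm1 : 1 ≤ a ^ n := one_le_pow₀ ha1
  have hm : 0 < a ^ n := by positivity
  rw [le_div_iff₀ (by positivity)] at hsle
  have h1 : s * (δ * a ^ n) ≤ C := by
    refine le_trans ?_ hsle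
    have : s * (δ * a ^ n) * 1 ≤ s * (δ * a ^ n) * (l * a) := by
      gcongr
      exact one_le_mul_of_one_le_of_one_le hδ1 ha1
    linarith
  constructor
  -- Multiplying by `C` allows the lower bound on `δ` to be used without dividing.
  · have h2 : (s * T) ^ 2 * C ≤ (1e-6) ^ 2 * C := by
      calc (s * T) ^ 2 * C ≤ (s * T) ^ 2 * C * (a * a ^ n) :=
            le_mul_of_one_le_right (by positivity) (one_le_mul_of_one_le_of_one_le ha1 hm1)
        _ = s ^ 2 * a ^ n * (C * a * T ^ 2) := by ring
        _ ≤ s ^ 2 * a ^ n * (δ ^ 2 * a ^ n) := by gcongr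
        _ = (s * (δ * a ^ n)) ^ 2 := by ring
        _ ≤ C ^ 2 := by gcongr
        _ = C * C := by ring
        _ ≤ _ := by norm_num at hC1 ⊢; gcongr
    exact le_of_sq_le_sq (le_of_mul_le_mul_right h2 hC) (by norm_num)
  · rw [le_div_iff₀ (by positivity)]
    calc δ * (s * a ^ n) = s * (δ * a ^ n) := by ring
      _ ≤ c := h1.trans hc

theorem mainTheorem3 :
    ∃ C : ℝ, 0 < C ∧
      ∀ (Ω : Type*) [MeasurableSpace Ω] (μ : MeasureTheory.Measure Ω)
        [MeasureTheory.IsProbabilityMeasure μ] (η : ℕ → Ω → ℝ),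
        ProbabilityTheory.iIndepFun (fun t : ℕ => η (t + 1)) μ →
        (∀ t : ℕ, ProbabilityTheory.HasLaw (η (t + 1)) (ProbabilityTheory.gaussianReal 0 1) μ) →
        ∀ (a : ℝ), 1.1 ≤ a → ∀ (T : ℕ), 1 ≤ T →
        ∀ (aHat : Ω → ℝ),
          (∀ᵐ ω ∂μ, IsOLSEstimate (fun t => scalarState a η t ω) T (aHat ω)) →
        ∀ (δ : ℝ), 0 < δ → δ < Real.exp (-1) →
          (C * a ^ 2 * (T : ℝ) ^ 2 * a ^ (-(T : ℤ)) > δ ^ 2 →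
            δ ≤ μ.real {ω | |a - aHat ω| ≥
              C * (1 - a ^ (-2 : ℤ)) * δ / (-(a ^ 2 * (Real.log δ) ^ 3))}) ∧
          (C * a ^ 2 * (T : ℝ) ^ 2 * a ^ (-(T : ℤ)) ≤ δ ^ 2 →
            δ ≤ μ.real {ω | |a - aHat ω| ≥
              C * (1 - a ^ (-2 : ℤ)) / (-(δ * Real.log δ)) * a ^ (-(T : ℤ))}) := by
  have hpdf : 0 < gaussianPDFReal 0 1 101 := gaussianPDFReal_pos 0 1 101 one_ne_zero
  have hpdf1 := gaussianPDFReal_le_half 101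
  -- The second factor is the constant of the dichotomy; the small first factor makes the levels of
  -- both regimes satisfy its hypothesis and absorbs the remaining absolute constants.
  refine ⟨1e-12 * (3.6e-7 * gaussianPDFReal 0 1 101), by positivity, ?_⟩
  intro Ω _ μ _ η hind hlaw a ha T hT aHat hols δ hδ hδe
  set c := 3.6e-7 * gaussianPDFReal 0 1 101 with hc
  set C := 1e-12 * c
  have hc0 : 0 < c := by positivity
  have hC0 : 0 < C := by positivity
  have hCc : C ≤ c := by
    simp only [C]; norm_num; linarith
  have hC1 : C ≤ 1e-12 := by
    simp only [C, hc]; norm_num; linarith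
  obtain ⟨n, rfl⟩ : ∃ n, T = n + 1 := ⟨T - 1, by omega⟩
  have ha0 : 0 < a := by linarith
  have hl : 1 ≤ -Real.log δ := by
    have := (Real.log_lt_log hδ hδe).le
    rw [Real.log_exp] at this
    linarith
  have hl0 : 0 < -Real.log δ := by linarith
  have hδ64 : δ ≤ 0.64 := by
    have := Real.exp_neg_one_lt_d9
    norm_num at this ⊢; linarith
  have hpow : a ^ (-((n + 1 : ℕ) : ℤ)) = (a * a ^ n)⁻¹ := by
    rw [zpow_neg, zpow_natCast, pow_succ']
  have hb0 : 0 < 1 - a ^ (-2 : ℤ) := by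
    have : a ^ (-2 : ℤ) < 1 := zpow_lt_one_of_neg₀ (by linarith) (by norm_num)
    linarith
  have hb1 : 1 - a ^ (-2 : ℤ) ≤ 1 := by
    have : 0 < a ^ (-2 : ℤ) := by positivity
    linarith
  have hcond : C * a ^ 2 * ((n + 1 : ℕ) : ℝ) ^ 2 * a ^ (-((n + 1 : ℕ) : ℤ)) =
      C * a * (n + 1) ^ 2 / a ^ n := by
    rw [hpow]; push_cast; field_simp
  have hm : 0 < a ^ n := by positivity
  have concl : ∀ s : ℝ, 0 < s → s * (n + 1) ≤ 1e-6 ∧ δ ≤ c / (s * a ^ n) →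
      δ ≤ μ.real {ω | |a - aHat ω| ≥ s} := by
    rintro s hs ⟨h1, h2⟩
    rcases measureReal_abs_sub_olsEstimate_ge_dichotomy hind hlaw ha hols hs h1 with h | h
    · exact hδ64.trans h
    · exact h2.trans h
  rw [hcond]
  refine ⟨fun h => ?_, fun h => ?_⟩
  · rw [gt_iff_lt, lt_div_iff₀ hm] at h
    have hden : -(a ^ 2 * Real.log δ ^ 3) = a ^ 2 * (-Real.log δ) ^ 3 := by ring
    rw [hden]
    have hs : 0 < C * (1 - a ^ (-2 : ℤ)) * δ / (a ^ 2 * (-Real.log δ) ^ 3) := by positivity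
    refine concl _ hs (first_regime_level ha hC0 hC1 hCc hδ hl h hs ?_)
    gcongr
    exact mul_le_of_le_one_right hC0.le hb1
  · rw [div_le_iff₀ hm] at h
    have hden : -(δ * Real.log δ) = δ * -Real.log δ := by ring
    rw [hden, hpow, ← div_eq_mul_inv, div_div]
    have hs : 0 < C * (1 - a ^ (-2 : ℤ)) / (δ * -Real.log δ * (a * a ^ n)) := by positivity
    refine concl _ hs (second_regime_level ha hC0 hC1 hCc hδ hl h hs ?_)
    gcongr
    exact mul_le_of_le_one_right hC0.le hb1
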